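/- Let $n\ge 1$. A cube is a closed axis-parallel cube $Q\subset\mathbb{R}^n$ of positive side length, and $|\cdot|$ is Lebesgue measure. For a (Lebesgue) measurable $f\colon\mathbb{R}^n\to\mathbb{R}$, a number $\alpha\in\mathbb{R}$ is a median of $f$ on $Q$ if $$|Q\cap\{f<\alpha\}|\le |Q|/2\quad\text{and}\quad |Q\cap\{f>\alpha\}|\le |Q|/2 .$$ The medians of $f$ on $Q$ form a non-empty compact interval; let $m_f(Q)$ be a median with the largest absolute value. The median maximal operator is $$\mathcal{M}f(x)=\sup_{Q\ni x}|m_f(Q)|\in[0,\infty],\qquad x\in\mathbb{R}^n,$$ the supremum being over all cubes $Q$ containing $x$. A weight is a measurable function $w\colon\mathbb{R}^n\to[0,\infty)$; write $w(Q)=\int_Q w$. Put $$[w]_{A_1}=\sup_Q \frac{w(Q)}{|Q|}\,\|w^{-1}\|_{L^\infty(Q)},\qquad [w]_{A_q}=\sup_Q \frac{w(Q)}{|Q|}\Big(\frac{1}{|Q|}\int_Q w^{-1/(q-1)}\Big)^{q-1}\quad(1<q<\infty),$$ where the suprema are over all cubes, $0$ raised to a negative power is $\infty$, and $0\cdot\infty=0$.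 Let $A_q$ be the class of weights with $[w]_{A_q}<\infty$, and $A_\infty=\bigcup_{1\le q<\infty}A_q$. Theorem. Let $w$ be a weight on $\mathbb{R}^n$ and let $p\in(0,\infty)$. Then $\mathcal{M}$ is bounded on $L^p(w)$ if and only if $w\in A_\infty$. Here $\mathcal{M}$ is bounded on $L^p(w)$ if there is a constant $C<\infty$ such that for every measurable $f\colon\mathbb{R}^n\to\mathbb{R}$ with $\int_{\mathbb{R}^n}|f|^p\,w\,dx<\infty$, the function $\mathcal{M}f$ is measurable and $$\Big(\int_{\mathbb{R}^n}(\mathcal{M}f)^p\,w\,dx\Big)^{1/p}\le C\Big(\int_{\mathbb{R}^n}|f|^p\,w\,dx\Big)^{1/p}.$$ -/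

import Mathlib

open MeasureTheory Set
open scoped ENNReal NNReal

namespace MedianMaximal

variable {n : ℕ}

/-- `Q` is a (closed, non-degenerate, axis-parallel) cube in `ℝⁿ`: the cube with centre `c` and
side length `2 * r`, for some `c` and some `r > 0`. -/
def IsCube (Q : Set (Fin n → ℝ)) : Prop :=
  ∃ (c : Fin n → ℝ) (r : ℝ), 0 < r ∧ Q = Icc (fun i => c i - r) (fun i => c i + r)

/-- `α` is a median of `f` on `Q`. -/
def IsMedian (f : (Fin n → ℝ) → ℝ) (Q : Set (Fin n → ℝ)) (α : ℝ) : Prop :=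
  volume (Q ∩ {x | f x < α}) ≤ volume Q / 2 ∧ volume (Q ∩ {x | α < f x}) ≤ volume Q / 2

/-- `α` is a median of `f` on `Q` with the largest absolute value. -/
def IsLargestMedian (f : (Fin n → ℝ) → ℝ) (Q : Set (Fin n → ℝ)) (α : ℝ) : Prop :=
  IsMedian f Q α ∧ ∀ β, IsMedian f Q β → |β| ≤ |α|

open Classical in
/-- The median `m_f(Q)` of `f` on `Q` with the largest absolute value. For a cube `Q` and a
measurable `f` it exists, see `isLargestMedian_largestMedian`. Its absolute value is unique
(and only the absolute value is used). -/
noncomputable def largestMedian (f : (Fin n → ℝ) → ℝ) (Q : Set (Fin n → ℝ)) : ℝ :=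
  if h : ∃ α, IsLargestMedian f Q α then h.choose else 0

/-- The median maximal function `𝓜 f (x) = sup_{Q ∋ x} |m_f(Q)|`, with values in `[0, ∞]`. -/
noncomputable def medianMaximal (f : (Fin n → ℝ) → ℝ) (x : Fin n → ℝ) : ℝ≥0∞ :=
  ⨆ (Q : Set (Fin n → ℝ)) (_ : IsCube Q) (_ : x ∈ Q), ENNReal.ofReal |largestMedian f Q|

/-- The measure `w dx` associated with a weight `w`. -/
noncomputable def weightMeasure (w : (Fin n → ℝ) → ℝ≥0) : Measure (Fin n → ℝ) :=
  volume.withDensity (fun x => (w x : ℝ≥0∞))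

/-- `T`, acting on real Lebesgue measurable functions, is bounded on `L^p(w)`, `0 < p < ∞`: there
is a finite constant `C` such that, for all `f ∈ L^p(w)`, the function `T f` is Lebesgue measurable
and `‖T f‖_{L^p(w)} ≤ C ‖f‖_{L^p(w)}`. -/
def IsBoundedOnLp (T : ((Fin n → ℝ) → ℝ) → (Fin n → ℝ) → ℝ≥0∞) (p : ℝ)
    (w : (Fin n → ℝ) → ℝ≥0) : Prop :=
  ∃ C : ℝ≥0, ∀ f : (Fin n → ℝ) → ℝ, AEMeasurable f volume →
    eLpNorm f (ENNReal.ofReal p) (weightMeasure w) < ∞ →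
      AEMeasurable (T f) volume ∧
        eLpNorm (T f) (ENNReal.ofReal p) (weightMeasure w) ≤
          C * eLpNorm f (ENNReal.ofReal p) (weightMeasure w)

/-- The constant `[w]_{A_1} = sup_Q (w(Q) / |Q|) ‖w⁻¹‖_{L^∞(Q)}` (in `[0, ∞]`, with `0⁻¹ = ∞` and
`0 * ∞ = 0`). -/
noncomputable def a1Const (w : (Fin n → ℝ) → ℝ≥0) : ℝ≥0∞ :=
  ⨆ (Q : Set (Fin n → ℝ)) (_ : IsCube Q),
    (∫⁻ x in Q, (w x : ℝ≥0∞)) / volume Q *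
      essSup (fun x => (w x : ℝ≥0∞)⁻¹) (volume.restrict Q)

/-- The constant `[w]_{A_p} = sup_Q (w(Q) / |Q|) (σ(Q) / |Q|)^(p-1)` with `σ = w^(-1/(p-1))`, for
`1 < p < ∞` (in `[0, ∞]`, with `0^(-1/(p-1)) = ∞` and `0 * ∞ = 0`). -/
noncomputable def apConst (p : ℝ) (w : (Fin n → ℝ) → ℝ≥0) : ℝ≥0∞ :=
  ⨆ (Q : Set (Fin n → ℝ)) (_ : IsCube Q),
    (∫⁻ x in Q, (w x : ℝ≥0∞)) / volume Q *
      ((∫⁻ x in Q, (w x : ℝ≥0∞) ^ (-1 / (p - 1))) / volume Q) ^ (p - 1)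

/-- The class `A_∞`, the union of the Muckenhoupt classes `A_p`, `1 ≤ p < ∞`. -/
def IsAInfty (w : (Fin n → ℝ) → ℝ≥0) : Prop :=
  a1Const w < ∞ ∨ ∃ p : ℝ, 1 < p ∧ apConst p w < ∞

theorem IsCube.volume_ne_zero {Q : Set (Fin n → ℝ)} (hQ : IsCube Q) : volume Q ≠ 0 := by
  obtain ⟨c, r, hr, rfl⟩ := hQ
  rw [Real.volume_Icc_pi, Finset.prod_ne_zero_iff]
  intro i _
  rw [ne_eq, ENNReal.ofReal_eq_zero, not_le]
  linarith

theorem IsCube.volume_ne_top {Q : Set (Fin n → ℝ)} (hQ : IsCube Q) : volume Q ≠ ∞ := by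
  obtain ⟨c, r, hr, rfl⟩ := hQ
  exact isCompact_Icc.measure_ne_top

theorem IsCube.measurableSet {Q : Set (Fin n → ℝ)} (hQ : IsCube Q) : MeasurableSet Q := by
  obtain ⟨c, r, hr, rfl⟩ := hQ
  exact measurableSet_Icc

/-- A bound for all superlevel sets above `α` passes to `α`. -/
theorem measure_lt_le_of_forall {μ : Measure (Fin n → ℝ)} {g : (Fin n → ℝ) → ℝ} {α : ℝ} {b : ℝ≥0∞}
    (h : ∀ t, α < t → μ {x | t < g x} ≤ b) : μ {x | α < g x} ≤ b := by
  have hU : {x | α < g x} = ⋃ k : ℕ, {x | α + 1 / ((k : ℝ) + 1) < g x} := by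
    ext x
    simp only [mem_ofPred_eq, mem_iUnion]
    constructor
    · intro hx
      obtain ⟨k, hk⟩ := exists_nat_one_div_lt (sub_pos.2 hx)
      exact ⟨k, by linarith⟩
    · rintro ⟨k, hk⟩
      have : (0 : ℝ) < 1 / ((k : ℝ) + 1) := by positivity
      linarith
  have hm : Monotone fun k : ℕ => {x | α + 1 / ((k : ℝ) + 1) < g x} := by
    intro k l hkl x hx
    have : 1 / ((l : ℝ) + 1) ≤ 1 / ((k : ℝ) + 1) := by gcongr
    simp only [mem_ofPred_eq] at hx ⊢
    linarith
  rw [hU, hm.measure_iUnion]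
  refine iSup_le fun k => h _ ?_
  have : (0 : ℝ) < 1 / ((k : ℝ) + 1) := by positivity
  linarith

/-- Superlevel sets at high levels have small measure. -/
theorem exists_measure_lt_lt {μ : Measure (Fin n → ℝ)} [IsFiniteMeasure μ] {g : (Fin n → ℝ) → ℝ}
    (hg : AEMeasurable g μ) {b : ℝ≥0∞} (hb : 0 < b) : ∃ t : ℝ, μ {x | t < g x} < b := by
  have hI : (⋂ k : ℕ, {x | (k : ℝ) < g x}) = ∅ := by
    refine eq_empty_of_forall_notMem fun x hx => ?_
    obtain ⟨k, hk⟩ := exists_nat_ge (g x)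
    exact absurd (mem_iInter.1 hx k) (not_lt.2 hk)
  have hT := tendsto_measure_iInter_atTop (μ := μ) (s := fun k : ℕ => {x | (k : ℝ) < g x})
    (fun k => nullMeasurableSet_lt aemeasurable_const hg)
    (fun k l hkl x (hx : (l : ℝ) < g x) => show (k : ℝ) < g x from
      lt_of_le_of_lt (Nat.cast_le.2 hkl) hx) ⟨0, measure_ne_top _ _⟩
  rw [hI, measure_empty] at hT
  obtain ⟨k, hk⟩ := (hT.eventually (gt_mem_nhds hb)).exists
  exact ⟨k, hk⟩

/-- A measurable function has a median with the largest absolute value on every cube. -/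
theorem exists_isLargestMedian {f : (Fin n → ℝ) → ℝ} (hf : AEMeasurable f volume)
    {Q : Set (Fin n → ℝ)} (hQ : IsCube Q) : ∃ α, IsLargestMedian f Q α := by
  set μ : Measure (Fin n → ℝ) := volume.restrict Q with hμ
  have : IsFiniteMeasure μ := ⟨by simpa [hμ] using hQ.volume_ne_top.lt_top⟩
  have hfμ : AEMeasurable f μ := hf.restrict
  set b : ℝ≥0∞ := volume Q / 2 with hb
  have hb0 : 0 < b := ENNReal.half_pos hQ.volume_ne_zero
  have hU : μ univ = b + b := by simp [hμ, hb, ENNReal.add_halves]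
  have hiff : ∀ α, IsMedian f Q α ↔ μ {x | f x < α} ≤ b ∧ μ {x | α < f x} ≤ b := by
    intro α
    simp only [IsMedian, hμ, Measure.restrict_apply' hQ.measurableSet, inter_comm Q, hb]
  have hlt : ∀ α, (∀ t, t < α → μ {x | f x < t} ≤ b) → μ {x | f x < α} ≤ b := by
    intro α h
    have := measure_lt_le_of_forall (μ := μ) (g := fun x => -f x) (α := -α) (b := b)
      (fun t ht => by simpa [lt_neg] using h (-t) (by linarith))
    simpa using this
  have hsplit : ∀ t, μ {x | f x ≤ t} + μ {x | t < f x} = b + b := by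
    intro t
    rw [← hU, ← measure_add_measure_compl₀ (nullMeasurableSet_le hfμ aemeasurable_const :
      NullMeasurableSet {x | f x ≤ t} μ)]
    congr 2
    ext x
    simp
  obtain ⟨t₁, ht₁⟩ := exists_measure_lt_lt hfμ hb0
  obtain ⟨t₂', ht₂'⟩ := exists_measure_lt_lt hfμ.neg hb0
  obtain ⟨t₂, rfl⟩ : ∃ t₂, t₂' = -t₂ := ⟨-t₂', by simp⟩
  have ht₂ : μ {x | f x < t₂} < b := by simpa using ht₂'
  have hlow : ∀ t, t < t₂ → b < μ {x | t < f x} := by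
    intro t ht
    by_contra! h
    have h1 : μ {x | f x ≤ t} < b :=
      (measure_mono fun x (hx : f x ≤ t) => lt_of_le_of_lt hx ht).trans_lt ht₂
    exact (ENNReal.add_lt_add_of_lt_of_le (measure_ne_top _ _) h1 h).ne (hsplit t)
  have hup : ∀ t, t₁ < t → b < μ {x | f x < t} := by
    intro t ht
    by_contra! h
    have h1 : μ {x | f x ≤ t₁} ≤ b :=
      (measure_mono fun x (hx : f x ≤ t₁) => lt_of_le_of_lt hx ht).trans h
    refine (ENNReal.add_lt_add_of_le_of_lt (measure_ne_top _ _) h1 ht₁).ne (hsplit t₁)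
  set S : Set ℝ := {α | IsMedian f Q α} with hS
  have hsub : S ⊆ Icc t₂ t₁ := by
    intro α hα
    obtain ⟨h1, h2⟩ := (hiff α).1 hα
    exact ⟨not_lt.1 fun h => absurd h2 (not_le.2 (hlow α h)),
      not_lt.1 fun h => absurd h1 (not_le.2 (hup α h))⟩
  have hcl : IsClosed S := by
    refine isClosed_of_closure_subset fun α hα => (hiff α).2 ⟨hlt α fun t ht => ?_,
      measure_lt_le_of_forall fun t ht => ?_⟩
    · obtain ⟨s, hs, hsS⟩ := mem_closure_iff.1 hα (Ioi t) isOpen_Ioi ht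
      exact (measure_mono fun x (hx : f x < t) => hx.trans hs).trans ((hiff s).1 hsS).1
    · obtain ⟨s, hs, hsS⟩ := mem_closure_iff.1 hα (Iio t) isOpen_Iio ht
      exact (measure_mono fun x (hx : t < f x) => lt_trans hs hx).trans ((hiff s).1 hsS).2
  have hne : S.Nonempty := by
    set T : Set ℝ := {t | μ {x | t < f x} ≤ b} with hT
    have hTb : BddBelow T := ⟨t₂, fun t ht => not_lt.1 fun h => absurd ht (not_le.2 (hlow t h))⟩
    have hTn : T.Nonempty := ⟨t₁, ht₁.le⟩
    refine ⟨sInf T, (hiff _).2 ⟨hlt _ fun t ht => ?_, measure_lt_le_of_forall fun t ht => ?_⟩⟩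
    · have h1 : b < μ {x | t < f x} := not_le.1 fun h => absurd (csInf_le hTb h) (not_le.2 ht)
      have h2 : μ {x | f x ≤ t} ≤ b := by
        by_contra! h
        exact (ENNReal.add_lt_add h h1).ne' (hsplit t)
      exact (measure_mono fun x (hx : f x < t) => hx.le).trans h2
    · obtain ⟨s, hs, hst⟩ := exists_lt_of_csInf_lt hTn ht
      exact (measure_mono fun x (hx : t < f x) => hst.trans hx).trans hs
  obtain ⟨α, hα, hmax⟩ := (isCompact_Icc.of_isClosed_subset hcl hsub).exists_isMaxOn hne
    continuous_abs.continuousOn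
  exact ⟨α, hα, fun β hβ => hmax hβ⟩

theorem isLargestMedian_largestMedian {f : (Fin n → ℝ) → ℝ} (hf : AEMeasurable f volume)
    {Q : Set (Fin n → ℝ)} (hQ : IsCube Q) : IsLargestMedian f Q (largestMedian f Q) := by
  have h := exists_isLargestMedian hf hQ
  rw [largestMedian, dif_pos h]
  exact h.choose_spec

end MedianMaximal

open Metric Filter Topology

namespace MedianMaximal

variable {n : ℕ}

/-! Both sides are equivalent to the estimate `HullBounded`: adding to a set E all cubes at least
half filled by E multiplies its w-measure by at most a constant. The exponent p plays no role in it.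

If |m_f(Q)| > t, then |f| > t on at least half of Q, so {𝓜f > t} lies in the hull of {|f| > t}. The
hull estimate therefore compares distribution functions, and the layer-cake formula turns this into
a norm bound. Conversely, 𝓜 of an indicator 1_E is at least 1 on the hull of E, so Chebyshev
recovers the hull estimate.

For w in A_q, Hölder gives w(5Q) ≤ C w(E ∩ Q) whenever E fills half of Q, and Vitali's covering
lemma sums this over the hull (`hullBounded_of_forall_volume_le_mul`).

For the converse, a subset of Q filling at most half of it can be enlarged so that its volume grows
by a fixed factor 1/θ > 1 while its w-measure grows at most by the factor K + 1
(`exists_superset_volume_ge`). Iteration bounds w(Q) by (K + 1)^(N+1) w(E) once |E| ≥ θ^N |Q| / 2.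
Hence the sublevel sets of w in Q decay geometrically (`volume_sublevel_le`), so w^(-δ) has
controlled averages for some δ > 0, which is the A_q condition with q = 1 + 1/δ. -/

/-! ### Cubes as sup-norm balls, and their homotheties -/

theorem Icc_eq_closedBall (c : Fin n → ℝ) {r : ℝ} (hr : 0 < r) :
    Icc (fun i => c i - r) (fun i => c i + r) = closedBall c r := by
  rw [closedBall_pi c hr.le, ← pi_univ_Icc]
  simp only [Real.closedBall_eq_Icc]

theorem isCube_iff {Q : Set (Fin n → ℝ)} :
    IsCube Q ↔ ∃ (c : Fin n → ℝ) (r : ℝ), 0 < r ∧ Q = closedBall c r := by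
  constructor
  · rintro ⟨c, r, hr, rfl⟩
    exact ⟨c, r, hr, Icc_eq_closedBall c hr⟩
  · rintro ⟨c, r, hr, rfl⟩
    exact ⟨c, r, hr, (Icc_eq_closedBall c hr).symm⟩

theorem isCube_closedBall (c : Fin n → ℝ) {r : ℝ} (hr : 0 < r) : IsCube (closedBall c r) :=
  isCube_iff.2 ⟨c, r, hr, rfl⟩

theorem volume_closedBall_mul (x y : Fin n → ℝ) {s r : ℝ} (hs : 0 ≤ s) (hr : 0 ≤ r) :
    volume (closedBall x (s * r)) = ENNReal.ofReal (s ^ n) * volume (closedBall y r) := by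
  rw [Real.volume_pi_closedBall _ (by positivity), Real.volume_pi_closedBall _ hr,
    ← ENNReal.ofReal_mul (by positivity), Fintype.card_fin]
  congr 1
  rw [← mul_pow]
  ring

/-- The images of a cube under homotheties centred at one of its points x are nested: the centres
are at most (t - s) r apart. -/
theorem closedBall_homothety_subset {x c : Fin n → ℝ} {r s t : ℝ} (hst : s ≤ t)
    (hx : x ∈ closedBall c r) :
    closedBall (x + s • (c - x)) (s * r) ⊆ closedBall (x + t • (c - x)) (t * r) := by
  refine closedBall_subset_closedBall' ?_
  have h : dist x c ≤ r := hx
  have : dist (x + s • (c - x)) (x + t • (c - x)) = (t - s) * dist x c := by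
    rw [dist_add_left, dist_eq_norm, ← sub_smul, norm_smul, Real.norm_eq_abs, abs_sub_comm,
      abs_of_nonneg (by linarith), dist_comm, dist_eq_norm]
  rw [this]
  nlinarith

theorem closedBall_homothety_subset_self {x c : Fin n → ℝ} {r s : ℝ} (hs1 : s ≤ 1)
    (hx : x ∈ closedBall c r) :
    closedBall (x + s • (c - x)) (s * r) ⊆ closedBall c r := by
  simpa using closedBall_homothety_subset hs1 hx

theorem mem_closedBall_homothety {x c : Fin n → ℝ} {r s : ℝ} (hs : 0 ≤ s)
    (hx : x ∈ closedBall c r) : x ∈ closedBall (x + s • (c - x)) (s * r) := by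
  have h : dist x c ≤ r := hx
  rw [mem_closedBall, dist_self_add_right, norm_smul, Real.norm_of_nonneg hs, ← dist_eq_norm,
    dist_comm]
  gcongr

/-! ### Measurability of the maximal function -/

/-- A set that is a union of closed cubes of positive side length is Lebesgue measurable. -/
theorem nullMeasurableSet_of_forall_mem_closedBall {U : Set (Fin n → ℝ)}
    (hU : ∀ x ∈ U, ∃ (c : Fin n → ℝ) (r : ℝ), 0 < r ∧ x ∈ closedBall c r ∧ closedBall c r ⊆ U) :
    NullMeasurableSet U := by
  set t : Set ((Fin n → ℝ) × (Fin n → ℝ) × ℝ) :=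
    {a | a.1 ∈ closedBall a.2.1 a.2.2 ∧ 0 < a.2.2 ∧ closedBall a.2.1 a.2.2 ⊆ U} with ht
  -- Members are (point, centre, radius). A cube of radius r lies in the ball of radius 2r about any
  -- of its points; tripling this ball gives the constant 6^n.
  obtain ⟨u, hut, huc, -, hu⟩ := Vitali.exists_disjoint_covering_ae (volume : Measure (Fin n → ℝ))
    U t (Real.toNNReal (6 ^ n)) (fun a => 2 * a.2.2) (fun a => a.1)
    (fun a => closedBall a.2.1 a.2.2)
    (fun a ha => closedBall_subset_closedBall' (by
      have : dist a.1 a.2.1 ≤ a.2.2 := ha.1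
      rw [dist_comm] at this
      linarith))
    (fun a ha => by
      rw [show 3 * (2 * a.2.2) = 6 * a.2.2 by ring,
        volume_closedBall_mul _ a.2.1 (by norm_num) ha.2.1.le]
      rfl)
    (fun a ha => (nonempty_ball.2 ha.2.1).mono ball_subset_interior_closedBall)
    (fun a ha => isClosed_closedBall)
    -- The covering is fine at x: shrinking a cube towards x keeps x in it and stays inside U.
    (fun x hx ε hε => by
      obtain ⟨c, r, hr, hxc, hcU⟩ := hU x hx
      have hs : 0 < min 1 (ε / (2 * r)) := by positivity
      refine ⟨(x, x + min 1 (ε / (2 * r)) • (c - x), min 1 (ε / (2 * r)) * r),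
        ⟨mem_closedBall_homothety hs.le hxc, by positivity,
          (closedBall_homothety_subset_self (min_le_left _ _) hxc).trans hcU⟩, ?_, rfl⟩
      have : min 1 (ε / (2 * r)) * (2 * r) ≤ ε / (2 * r) * (2 * r) := by
        gcongr
        exact min_le_right _ _
      rw [div_mul_cancel₀ _ (by positivity)] at this
      simp only
      linarith)
  have hsub : (⋃ a ∈ u, closedBall a.2.1 a.2.2) ⊆ U := iUnion₂_subset fun a ha => (hut ha).2.2
  have : U = (⋃ a ∈ u, closedBall a.2.1 a.2.2) ∪ (U \ ⋃ a ∈ u, closedBall a.2.1 a.2.2) := by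
    rw [union_sdiff_self, union_eq_right.2 hsub]
  rw [this]
  exact (NullMeasurableSet.biUnion huc fun a _ => isClosed_closedBall.nullMeasurableSet).union
    (NullMeasurableSet.of_null hu)

theorem lt_medianMaximal_iff {f : (Fin n → ℝ) → ℝ} {x : Fin n → ℝ} {a : ℝ≥0∞} :
    a < medianMaximal f x ↔
      ∃ Q, IsCube Q ∧ x ∈ Q ∧ a < ENNReal.ofReal |largestMedian f Q| := by
  simp only [medianMaximal, lt_iSup_iff, exists_prop]

theorem aemeasurable_of_nullMeasurableSet_lt {α : Type*} [MeasurableSpace α] {μ : Measure α}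
    {g : α → ℝ≥0∞} (h : ∀ a, NullMeasurableSet {x | a < g x} μ) : AEMeasurable g μ := by
  have : Measurable (α := NullMeasurableSpace α μ) g := measurable_of_Ioi h
  exact NullMeasurable.aemeasurable this

/-- A cube witnessing 𝓜f > a at one point does so at all its points, so superlevel sets are unions
of cubes. -/
theorem aemeasurable_medianMaximal (f : (Fin n → ℝ) → ℝ) :
    AEMeasurable (medianMaximal f) volume := by
  refine aemeasurable_of_nullMeasurableSet_lt fun a => ?_
  refine nullMeasurableSet_of_forall_mem_closedBall fun x hx => ?_
  obtain ⟨Q, hQ, hxQ, ha⟩ := lt_medianMaximal_iff.1 hx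
  obtain ⟨c, r, hr, rfl⟩ := isCube_iff.1 hQ
  exact ⟨c, r, hr, hxQ, fun y hy => lt_medianMaximal_iff.2 ⟨_, hQ, hy, ha⟩⟩

/-! ### The half-density hull -/

/-- The points that lie in a cube at least half of which is filled by `E`. -/
def halfDensityHull (E : Set (Fin n → ℝ)) : Set (Fin n → ℝ) :=
  {x | ∃ Q, IsCube Q ∧ x ∈ Q ∧ volume Q ≤ 2 * volume (E ∩ Q)}

theorem IsCube.subset_halfDensityHull {E Q : Set (Fin n → ℝ)} (hQ : IsCube Q)
    (h : volume Q ≤ 2 * volume (E ∩ Q)) : Q ⊆ halfDensityHull E :=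
  fun _ hx => ⟨Q, hQ, hx, h⟩

/-- Filling up cubes that are at least half full does not increase `μ` by more than a
constant factor. -/
def HullBounded (μ : Measure (Fin n → ℝ)) : Prop :=
  ∃ K : ℝ≥0, ∀ E, MeasurableSet E → μ (halfDensityHull E) ≤ K * μ E

theorem exists_disjoint_subfamily_closedBall (t : Set ((Fin n → ℝ) × ℝ)) (ht : ∀ a ∈ t, 0 < a.2)
    {R : ℝ} (hR : ∀ a ∈ t, a.2 ≤ R) :
    ∃ u ⊆ t, u.Countable ∧ u.PairwiseDisjoint (fun a => closedBall a.1 a.2) ∧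
      ∀ a ∈ t, ∃ b ∈ u, closedBall a.1 a.2 ⊆ closedBall b.1 (5 * b.2) := by
  obtain ⟨u, hut, hd, hu⟩ := Vitali.exists_disjoint_subfamily_covering_enlargement_closedBall t
    (fun a => a.1) (fun a => a.2) R hR 5 (by norm_num)
  exact ⟨u, hut, hd.countable_of_nonempty_interior fun a ha =>
    (nonempty_ball.2 (ht a (hut ha))).mono ball_subset_interior_closedBall, hd, hu⟩

theorem halfDensityHull_congr {E F : Set (Fin n → ℝ)} (h : E =ᵐ[volume] F) :
    halfDensityHull E = halfDensityHull F := by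
  have (Q : Set (Fin n → ℝ)) : volume (E ∩ Q) = volume (F ∩ Q) :=
    measure_congr (h.inter (ae_eq_refl Q))
  simp only [halfDensityHull, this]

/-- The hull only sees E up to null sets. Needed because superlevel sets of an a.e. measurable f are
only null measurable. -/
theorem HullBounded.exists_nullMeasurableSet {μ : Measure (Fin n → ℝ)} (h : HullBounded μ)
    (hμ : μ ≪ volume) :
    ∃ K : ℝ≥0, ∀ E, NullMeasurableSet E volume → μ (halfDensityHull E) ≤ K * μ E := by
  obtain ⟨K, hK⟩ := h
  refine ⟨K, fun E hE => ?_⟩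
  obtain ⟨F, hF, hEF⟩ := hE
  rw [halfDensityHull_congr hEF, measure_congr (hμ.ae_eq hEF)]
  exact hK F hF

/-! ### Boundedness of 𝓜 and the hull estimate -/

/-- Here 1 is a median of the indicator. When E fills exactly half of Q, 0 is a median too, so
taking the largest one matters. -/
theorem one_le_abs_largestMedian_indicator {E Q : Set (Fin n → ℝ)} (hE : MeasurableSet E)
    (hQ : IsCube Q) (h : volume Q ≤ 2 * volume (E ∩ Q)) :
    1 ≤ |largestMedian (E.indicator 1) Q| := by
  have hm : Measurable (E.indicator (1 : (Fin n → ℝ) → ℝ)) := measurable_one.indicator hE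
  have hmed : IsMedian (E.indicator 1) Q 1 := by
    constructor
    · have h1 : volume (E ∩ Q) + volume (Q \ E) = volume Q := by
        rw [inter_comm]
        exact measure_inter_add_sdiff Q hE
      have h2 : Q ∩ {x | E.indicator 1 x < (1 : ℝ)} ⊆ Q \ E := by
        rintro x ⟨hx, hx1⟩
        refine ⟨hx, fun hxE => ?_⟩
        simp [hxE] at hx1
      refine (measure_mono h2).trans ?_
      have hfin : volume (E ∩ Q) ≠ ∞ := measure_ne_top_of_subset inter_subset_right hQ.volume_ne_top
      rw [ENNReal.le_div_iff_mul_le (by simp) (by simp)]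
      have : volume (Q \ E) ≤ volume (E ∩ Q) := by
        rw [← h1, two_mul] at h
        exact (ENNReal.add_le_add_iff_left hfin).1 h
      rw [mul_two]
      rw [← h1]
      gcongr
    · have : Q ∩ {x | (1 : ℝ) < E.indicator 1 x} = ∅ := by
        refine eq_empty_of_forall_notMem ?_
        rintro x ⟨-, hx⟩
        by_cases hxE : x ∈ E <;> simp [hxE] at hx
        linarith
      rw [this]
      simp
  simpa using (isLargestMedian_largestMedian hm.aemeasurable hQ).2 1 hmed

theorem IsBoundedOnLp.hullBounded {w : (Fin n → ℝ) → ℝ≥0} {p : ℝ} (hp : 0 < p)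
    (h : IsBoundedOnLp medianMaximal p w) : HullBounded (weightMeasure w) := by
  obtain ⟨C, hC⟩ := h
  have hac : weightMeasure w ≪ volume := withDensity_absolutelyContinuous _ _
  have hp0 : ENNReal.ofReal p ≠ 0 := by simpa using hp
  have htr : (ENNReal.ofReal p).toReal = p := ENNReal.toReal_ofReal hp.le
  -- The summand 1 keeps the constant positive, so that the bound is ∞ when E has infinite measure.
  refine ⟨C ^ p + 1, fun E hE => ?_⟩
  rcases eq_or_ne (weightMeasure w E) ∞ with hEt | hEt
  · rw [hEt, ENNReal.mul_top (by simp)]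
    exact le_top
  have hN : eLpNorm (E.indicator (1 : (Fin n → ℝ) → ℝ)) (ENNReal.ofReal p) (weightMeasure w) =
      weightMeasure w E ^ (1 / p) := by
    have := eLpNorm_indicator_const (μ := weightMeasure w) (c := (1 : ℝ)) hE hp0
      ENNReal.ofReal_ne_top
    rw [htr] at this
    rw [enorm_one, one_mul] at this
    exact this
  obtain ⟨hM, hle⟩ := hC (E.indicator 1) (measurable_one.indicator hE).aemeasurable (by
    rw [hN]
    exact ENNReal.rpow_lt_top_of_nonneg (by positivity) hEt)
  have hsub : halfDensityHull E ⊆ {x | 1 ≤ ‖medianMaximal (E.indicator 1) x‖ₑ} := by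
    rintro x ⟨Q, hQ, hxQ, hv⟩
    have h1 := one_le_abs_largestMedian_indicator hE hQ hv
    simp only [mem_ofPred_eq, enorm_eq_self]
    refine le_trans ?_ (le_iSup₂_of_le Q hQ (le_iSup_of_le hxQ le_rfl))
    simpa using h1
  calc weightMeasure w (halfDensityHull E)
      ≤ weightMeasure w {x | 1 ≤ ‖medianMaximal (E.indicator 1) x‖ₑ} := measure_mono hsub
    _ ≤ eLpNorm (medianMaximal (E.indicator 1)) (ENNReal.ofReal p) (weightMeasure w) ^ p := by
        have := mul_meas_ge_le_pow_eLpNorm' (weightMeasure w) hp0 ENNReal.ofReal_ne_top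
          (hM.mono_ac hac).aestronglyMeasurable 1
        simpa [htr] using this
    _ ≤ (C * weightMeasure w E ^ (1 / p)) ^ p := by
        rw [← hN]
        gcongr
    _ = (C ^ p : ℝ≥0) * weightMeasure w E := by
        rw [ENNReal.mul_rpow_of_nonneg _ _ hp.le, ← ENNReal.rpow_mul, one_div_mul_cancel hp.ne',
          ENNReal.rpow_one, ENNReal.coe_rpow_of_nonneg _ hp.le]
    _ ≤ (C ^ p + 1 : ℝ≥0) * weightMeasure w E := by
        gcongr
        exact le_self_add

/-- Points of Q with |f| ≤ t lie strictly below the median if it is positive and strictly above it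
if it is negative, hence occupy at most half of Q. -/
theorem volume_le_two_mul_of_lt_abs_largestMedian {f : (Fin n → ℝ) → ℝ}
    (hf : AEMeasurable f volume) {Q : Set (Fin n → ℝ)} (hQ : IsCube Q) {t : ℝ}
    (h : t < |largestMedian f Q|) : volume Q ≤ 2 * volume ({x | t < |f x|} ∩ Q) := by
  set α := largestMedian f Q
  obtain ⟨⟨h1, h2⟩, -⟩ : IsLargestMedian f Q α := isLargestMedian_largestMedian hf hQ
  have hcov : ∃ S, volume S ≤ volume Q / 2 ∧ Q ⊆ S ∪ ({x | t < |f x|} ∩ Q) := by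
    rcases lt_abs.1 h with h | h
    · refine ⟨_, h1, fun x hx => ?_⟩
      by_cases hxα : f x < α
      · exact Or.inl ⟨hx, hxα⟩
      · exact Or.inr ⟨show t < |f x| from lt_abs.2 (Or.inl (by linarith [not_lt.1 hxα])), hx⟩
    · refine ⟨_, h2, fun x hx => ?_⟩
      by_cases hxα : α < f x
      · exact Or.inl ⟨hx, hxα⟩
      · exact Or.inr ⟨show t < |f x| from lt_abs.2 (Or.inr (by linarith [not_lt.1 hxα])), hx⟩
  obtain ⟨S, hS, hQS⟩ := hcov
  have h3 : volume Q ≤ volume Q / 2 + volume ({x | t < |f x|} ∩ Q) :=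
    (measure_mono hQS).trans ((measure_union_le _ _).trans (by gcongr))
  have h4 : volume Q / 2 ≠ ∞ := ENNReal.div_ne_top hQ.volume_ne_top (by simp)
  have h5 : volume Q / 2 ≤ volume ({x | t < |f x|} ∩ Q) := by
    nth_rw 1 [← ENNReal.add_halves (volume Q)] at h3
    exact (ENNReal.add_le_add_iff_left h4).1 h3
  rw [← ENNReal.add_halves (volume Q), ← two_mul]
  gcongr

theorem setOf_lt_medianMaximal_subset {f : (Fin n → ℝ) → ℝ} (hf : AEMeasurable f volume) {t : ℝ}
    (ht : 0 ≤ t) :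
    {x | ENNReal.ofReal t < medianMaximal f x} ⊆ halfDensityHull {x | t < |f x|} := by
  intro x hx
  obtain ⟨Q, hQ, hxQ, hlt⟩ := lt_medianMaximal_iff.1 hx
  exact ⟨Q, hQ, hxQ, volume_le_two_mul_of_lt_abs_largestMedian hf hQ
    ((ENNReal.ofReal_lt_ofReal_iff_of_nonneg ht).1 hlt)⟩

/-- A comparison of distribution functions gives a comparison of `L^p` norms. -/
theorem lintegral_rpow_le_of_measure_lt_le {α : Type*} [MeasurableSpace α] {μ : Measure α}
    {f : α → ℝ} {g : α → ℝ≥0∞} (hf : AEMeasurable f μ) (hg : AEMeasurable g μ) {K : ℝ≥0} {p : ℝ}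
    (hp : 0 < p) (h : ∀ t : ℝ, 0 ≤ t → μ {x | ENNReal.ofReal t < g x} ≤ K * μ {x | t < |f x|})
    (hfin : ∫⁻ x, ‖f x‖ₑ ^ p ∂μ ≠ ∞) :
    ∫⁻ x, g x ^ p ∂μ ≤ K * ∫⁻ x, ‖f x‖ₑ ^ p ∂μ := by
  -- The layer-cake formula is applied to real functions. Chebyshev bounds the measure of {g = ∞} by
  -- K k^(-p) ∫ |f|^p, which tends to 0.
  have htop : ∀ᵐ x ∂μ, g x < ∞ := by
    have hk (k : ℕ) : μ {x | ¬ g x < ∞} ≤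
        K * ((∫⁻ x, ‖f x‖ₑ ^ p ∂μ) * ((k : ℝ≥0∞)⁻¹) ^ p) := by
      rcases eq_or_ne k 0 with rfl | hk0
      · rcases eq_or_ne (K * ∫⁻ x, ‖f x‖ₑ ^ p ∂μ) 0 with h0 | h0
        · rcases mul_eq_zero.1 h0 with h0 | h0
          · have := h 0 le_rfl
            simp only [h0, zero_mul, nonpos_iff_eq_zero] at this
            refine (measure_mono fun x hx => ?_).trans (this.le.trans zero_le)
            simp only [mem_ofPred_eq, not_lt, top_le_iff] at hx ⊢
            simp [hx]
          · have h1 : ∀ᵐ x ∂μ, f x = 0 := by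
              have := (lintegral_eq_zero_iff' ((hf.enorm).pow_const p)).1 h0
              filter_upwards [this] with x hx
              simpa [hp, hp.le, hp.ne'] using hx
            have h2 : μ {x | (0 : ℝ) < |f x|} = 0 := by
              rw [ae_iff] at h1
              simpa using h1
            have := h 0 le_rfl
            rw [h2, mul_zero] at this
            refine (measure_mono fun x hx => ?_).trans (this.trans zero_le)
            simp only [mem_ofPred_eq, not_lt, top_le_iff] at hx ⊢
            simp [hx]
        · rw [← mul_assoc]
          simp [hp, ENNReal.mul_top h0]
      · have h1 : μ {x | ¬ g x < ∞} ≤ μ {x | ENNReal.ofReal k < g x} := by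
          refine measure_mono fun x hx => ?_
          simp only [mem_ofPred_eq, not_lt, top_le_iff] at hx ⊢
          simp [hx]
        refine (h1.trans (h k k.cast_nonneg)).trans ?_
        gcongr
        have h2 : (k : ℝ≥0∞) ^ p * μ {x | (k : ℝ≥0∞) ^ p ≤ ‖f x‖ₑ ^ p} ≤ ∫⁻ x, ‖f x‖ₑ ^ p ∂μ :=
          mul_meas_ge_le_lintegral₀ (hf.enorm.pow_const p) _
        have h3 : {x | (k : ℝ) < |f x|} ⊆ {x | (k : ℝ≥0∞) ^ p ≤ ‖f x‖ₑ ^ p} := by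
          intro x hx
          simp only [mem_ofPred_eq] at hx ⊢
          gcongr
          rw [← ofReal_norm, Real.norm_eq_abs, ← ENNReal.ofReal_natCast]
          exact ENNReal.ofReal_le_ofReal hx.le
        rw [ENNReal.inv_rpow, ← div_eq_mul_inv,
          ENNReal.le_div_iff_mul_le (Or.inl (by simp [hk0])) (Or.inl (by simp [hp.le])),
          mul_comm]
        exact (mul_le_mul_right (measure_mono h3) _).trans h2
    have hT : Tendsto (fun k : ℕ => K * ((∫⁻ x, ‖f x‖ₑ ^ p ∂μ) * ((k : ℝ≥0∞)⁻¹) ^ p)) atTop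
        (𝓝 (K * ((∫⁻ x, ‖f x‖ₑ ^ p ∂μ) * (0 : ℝ≥0∞) ^ p))) :=
      ENNReal.Tendsto.const_mul (ENNReal.Tendsto.const_mul
        (((ENNReal.continuous_rpow_const (y := p)).tendsto 0).comp
          ENNReal.tendsto_inv_nat_nhds_zero) (Or.inr hfin)) (Or.inr ENNReal.coe_ne_top)
    rw [ENNReal.zero_rpow_of_pos hp, mul_zero, mul_zero] at hT
    have h0 : μ {x | ¬ g x < ∞} ≤ 0 := ge_of_tendsto' hT hk
    exact nonpos_iff_eq_zero.1 h0
  have hg' : ∫⁻ x, g x ^ p ∂μ = ∫⁻ x, ENNReal.ofReal ((g x).toReal ^ p) ∂μ := by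
    refine lintegral_congr_ae ?_
    filter_upwards [htop] with x hx
    rw [← ENNReal.ofReal_rpow_of_nonneg ENNReal.toReal_nonneg hp.le, ENNReal.ofReal_toReal hx.ne]
  have hf' : ∫⁻ x, ‖f x‖ₑ ^ p ∂μ = ∫⁻ x, ENNReal.ofReal (|f x| ^ p) ∂μ := by
    refine lintegral_congr fun x => ?_
    rw [← ENNReal.ofReal_rpow_of_nonneg (abs_nonneg _) hp.le, ← Real.norm_eq_abs,
      ofReal_norm]
  rw [hg', hf', lintegral_rpow_eq_lintegral_meas_lt_mul μ
      (Eventually.of_forall fun x => ENNReal.toReal_nonneg) hg.ennreal_toReal hp,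
    lintegral_rpow_eq_lintegral_meas_lt_mul μ
      (Eventually.of_forall fun x => abs_nonneg _) hf.norm hp, ← mul_assoc,
    mul_comm (K : ℝ≥0∞), mul_assoc, ← lintegral_const_mul' _ _ ENNReal.coe_ne_top]
  refine mul_le_mul_right ?_ _
  refine setLIntegral_mono' measurableSet_Ioi fun t ht => ?_
  rw [← mul_assoc]
  gcongr
  refine (measure_mono fun x hx => ?_).trans (h t (mem_Ioi.1 ht).le)
  rw [mem_ofPred_eq] at hx ⊢
  exact (ENNReal.ofReal_lt_ofReal_iff_of_nonneg (mem_Ioi.1 ht).le).2 hx |>.trans_le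
    ENNReal.ofReal_toReal_le

theorem HullBounded.isBoundedOnLp {w : (Fin n → ℝ) → ℝ≥0} {p : ℝ} (hp : 0 < p)
    (h : HullBounded (weightMeasure w)) : IsBoundedOnLp medianMaximal p w := by
  have hac : weightMeasure w ≪ volume := withDensity_absolutelyContinuous _ _
  obtain ⟨K, hK⟩ := h.exists_nullMeasurableSet hac
  have hp0 : ENNReal.ofReal p ≠ 0 := by simpa using hp
  have htr : (ENNReal.ofReal p).toReal = p := ENNReal.toReal_ofReal hp.le
  refine ⟨K ^ (1 / p), fun f hf hfin => ⟨aemeasurable_medianMaximal f, ?_⟩⟩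
  have hfin' : ∫⁻ x, ‖f x‖ₑ ^ p ∂(weightMeasure w) ≠ ∞ := by
    have := lintegral_rpow_enorm_lt_top_of_eLpNorm_lt_top hp0 ENNReal.ofReal_ne_top hfin
    rw [htr] at this
    exact this.ne
  have key := lintegral_rpow_le_of_measure_lt_le (hf.mono_ac hac)
    ((aemeasurable_medianMaximal f).mono_ac hac) (K := K) hp
    (fun t ht => (measure_mono (setOf_lt_medianMaximal_subset hf ht)).trans
      (hK _ (nullMeasurableSet_lt aemeasurable_const hf.norm))) hfin'
  rw [eLpNorm_eq_lintegral_rpow_enorm_toReal hp0 ENNReal.ofReal_ne_top,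
    eLpNorm_eq_lintegral_rpow_enorm_toReal hp0 ENNReal.ofReal_ne_top, htr,
    ENNReal.coe_rpow_of_nonneg _ (by positivity), ← ENNReal.mul_rpow_of_nonneg _ _ (by positivity)]
  gcongr
  simpa only [enorm_eq_self] using key

/-! ### From A_∞ to the hull estimate -/

/-- An average is at most the essential supremum; this reduces A_1 to the case q > 1. -/
theorem apConst_two_le_a1Const (w : (Fin n → ℝ) → ℝ≥0) : apConst 2 w ≤ a1Const w := by
  refine iSup₂_mono fun Q hQ => ?_
  have h1 : (2 : ℝ) - 1 = 1 := by norm_num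
  simp only [h1, div_one, ENNReal.rpow_one, ENNReal.rpow_neg_one]
  gcongr
  rw [ENNReal.div_le_iff hQ.volume_ne_zero hQ.volume_ne_top]
  calc ∫⁻ x in Q, (w x : ℝ≥0∞)⁻¹
      ≤ ∫⁻ _ in Q, essSup (fun x => (w x : ℝ≥0∞)⁻¹) (volume.restrict Q) :=
        lintegral_mono_ae (ENNReal.ae_le_essSup _)
    _ = _ := by rw [setLIntegral_const]

theorem IsAInfty.exists_apConst_lt_top {w : (Fin n → ℝ) → ℝ≥0} (h : IsAInfty w) :
    ∃ q : ℝ, 1 < q ∧ apConst q w < ∞ := by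
  rcases h with h | h
  · exact ⟨2, by norm_num, (apConst_two_le_a1Const w).trans_lt h⟩
  · exact h

theorem weightMeasure_apply (w : (Fin n → ℝ) → ℝ≥0) {S : Set (Fin n → ℝ)} (hS : MeasurableSet S) :
    weightMeasure w S = ∫⁻ x in S, (w x : ℝ≥0∞) :=
  withDensity_apply _ hS

theorem weightMeasure_mul_dual_le {w : (Fin n → ℝ) → ℝ≥0} {q : ℝ} (hq : 1 < q)
    {Q : Set (Fin n → ℝ)} (hQ : IsCube Q) :
    weightMeasure w Q * (∫⁻ x in Q, (w x : ℝ≥0∞) ^ (-1 / (q - 1))) ^ (q - 1) ≤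
      apConst q w * volume Q ^ q := by
  have h : (∫⁻ x in Q, (w x : ℝ≥0∞)) / volume Q *
      ((∫⁻ x in Q, (w x : ℝ≥0∞) ^ (-1 / (q - 1))) / volume Q) ^ (q - 1) ≤ apConst q w :=
    le_iSup₂_of_le Q hQ le_rfl
  have h0 := hQ.volume_ne_zero
  have ht := hQ.volume_ne_top
  have hq1 : 0 ≤ q - 1 := by linarith
  have hv : volume Q ^ q = volume Q * volume Q ^ (q - 1) := by
    nth_rw 2 [← ENNReal.rpow_one (volume Q)]
    rw [← ENNReal.rpow_add _ _ h0 ht]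
    congr 1
    ring
  rw [weightMeasure_apply w hQ.measurableSet]
  set W := ∫⁻ x in Q, (w x : ℝ≥0∞)
  set S := ∫⁻ x in Q, (w x : ℝ≥0∞) ^ (-1 / (q - 1))
  calc W * S ^ (q - 1) = (W / volume Q * volume Q) * (S / volume Q * volume Q) ^ (q - 1) := by
        rw [ENNReal.div_mul_cancel h0 ht, ENNReal.div_mul_cancel h0 ht]
    _ = (W / volume Q * (S / volume Q) ^ (q - 1)) * volume Q ^ q := by
        rw [ENNReal.mul_rpow_of_nonneg _ _ hq1, hv]
        ring
    _ ≤ _ := by gcongr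

/-- Hölder's inequality for a weight and its dual weight. -/
theorem volume_rpow_le_weightMeasure_mul_dual {w : (Fin n → ℝ) → ℝ≥0} (hw : AEMeasurable w volume)
    {q : ℝ} (hq : 1 < q) {F : Set (Fin n → ℝ)} (hF : MeasurableSet F)
    (hpos : ∀ᵐ x ∂(volume.restrict F), w x ≠ 0) :
    volume F ^ q ≤
      weightMeasure w F * (∫⁻ x in F, (w x : ℝ≥0∞) ^ (-1 / (q - 1))) ^ (q - 1) := by
  have hq0 : 0 < q := by linarith
  have hq1 : 0 < q - 1 := by linarith
  have hconj : q.HolderConjugate (q / (q - 1)) := Real.HolderConjugate.conjExponent hq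
  have hw' : AEMeasurable (fun x => (w x : ℝ≥0∞)) (volume.restrict F) :=
    hw.coe_nnreal_ennreal.restrict
  have hH := ENNReal.lintegral_mul_le_Lp_mul_Lq (volume.restrict F) hconj
    (f := fun x => (w x : ℝ≥0∞) ^ (1 / q)) (g := fun x => (w x : ℝ≥0∞) ^ (-1 / q))
    (hw'.pow_const _) (hw'.pow_const _)
  have h1 : ∫⁻ x in F, ((fun x => (w x : ℝ≥0∞) ^ (1 / q)) * fun x => (w x : ℝ≥0∞) ^ (-1 / q)) x =
      volume F := by
    rw [← setLIntegral_one]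
    refine lintegral_congr_ae ?_
    filter_upwards [hpos] with x hx
    have hx' : (w x : ℝ≥0∞) ≠ 0 := by simpa using hx
    simp only [Pi.mul_apply]
    rw [← ENNReal.rpow_add _ _ hx' ENNReal.coe_ne_top, neg_div, add_neg_cancel, ENNReal.rpow_zero]
  have h2 : ∫⁻ x in F, ((w x : ℝ≥0∞) ^ (1 / q)) ^ q = weightMeasure w F := by
    rw [weightMeasure_apply w hF]
    simp only [← ENNReal.rpow_mul, one_div_mul_cancel hq0.ne', ENNReal.rpow_one]
  have h3 : -1 / q * (q / (q - 1)) = -1 / (q - 1) := by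
    field_simp
  rw [h1, h2] at hH
  simp only [← ENNReal.rpow_mul, h3] at hH
  calc volume F ^ q ≤ (weightMeasure w F ^ (1 / q) *
        (∫⁻ x in F, (w x : ℝ≥0∞) ^ (-1 / (q - 1))) ^ (1 / (q / (q - 1)))) ^ q := by gcongr
    _ = _ := by
      rw [ENNReal.mul_rpow_of_nonneg _ _ hq0.le, ← ENNReal.rpow_mul, ← ENNReal.rpow_mul,
        one_div_mul_cancel hq0.ne', ENNReal.rpow_one]
      congr 2
      field_simp

/-- Hölder on F bounds |F|^q by w(F) times a power of the dual integral over Q, and the A_q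
condition on Q bounds that power. -/
theorem weightMeasure_le_mul_of_volume_le_mul {w : (Fin n → ℝ) → ℝ≥0} (hw : AEMeasurable w volume)
    {q : ℝ} (hq : 1 < q) (h : apConst q w < ∞) {Q F : Set (Fin n → ℝ)} (hQ : IsCube Q)
    (hF : MeasurableSet F) (hFQ : F ⊆ Q) {D : ℝ≥0∞} (hD : volume Q ≤ D * volume F) :
    weightMeasure w Q ≤ D ^ q * apConst q w * weightMeasure w F := by
  have hq0 : 0 < q := by linarith
  have hq1 : 0 < q - 1 := by linarith
  set S := ∫⁻ x in Q, (w x : ℝ≥0∞) ^ (-1 / (q - 1)) with hS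
  have hA := weightMeasure_mul_dual_le (w := w) hq hQ
  rcases eq_or_ne (weightMeasure w Q) 0 with h0 | h0
  · rw [h0]
    exact zero_le
  -- As w(Q) ≠ 0, the A_q bound forces the dual integral to be finite, hence w > 0 a.e. on Q, as
  -- Hölder requires.
  have hSt : S ≠ ∞ := by
    intro hSt
    rw [← hS, hSt, ENNReal.top_rpow_of_pos hq1, ENNReal.mul_top h0, top_le_iff] at hA
    exact ENNReal.mul_ne_top h.ne (ENNReal.rpow_ne_top_of_nonneg hq0.le hQ.volume_ne_top) hA
  have hpos : ∀ᵐ x ∂(volume.restrict Q), w x ≠ 0 := by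
    filter_upwards [ae_lt_top' (hw.coe_nnreal_ennreal.restrict.pow_const _) hSt] with x hx hx0
    rw [hx0, ENNReal.coe_zero, ENNReal.zero_rpow_of_neg (div_neg_of_neg_of_pos (by norm_num) hq1)]
      at hx
    exact hx.ne rfl
  have hH := volume_rpow_le_weightMeasure_mul_dual hw hq hF
    (ae_restrict_of_ae_restrict_of_subset hFQ hpos)
  have hv0 : volume Q ^ q ≠ 0 := by simp [hQ.volume_ne_zero, hQ.volume_ne_top]
  have hvt : volume Q ^ q ≠ ∞ := ENNReal.rpow_ne_top_of_nonneg hq0.le hQ.volume_ne_top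
  refine (ENNReal.mul_le_mul_iff_left hv0 hvt).1 ?_
  calc weightMeasure w Q * volume Q ^ q ≤ weightMeasure w Q * (D * volume F) ^ q := by gcongr
    _ = D ^ q * weightMeasure w Q * volume F ^ q := by
      rw [ENNReal.mul_rpow_of_nonneg _ _ hq0.le]
      ring
    _ ≤ D ^ q * weightMeasure w Q * (weightMeasure w F * S ^ (q - 1)) := by
      gcongr
      refine hH.trans ?_
      gcongr
      exact lintegral_mono_set hFQ
    _ = D ^ q * weightMeasure w F * (weightMeasure w Q * S ^ (q - 1)) := by ring
    _ ≤ D ^ q * weightMeasure w F * (apConst q w * volume Q ^ q) := by gcongr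
    _ = _ := by ring

theorem hullBounded_of_forall_volume_le_mul {μ : Measure (Fin n → ℝ)} {K : ℝ≥0}
    (h : ∀ Q F : Set (Fin n → ℝ), IsCube Q → MeasurableSet F → F ⊆ Q →
      volume Q ≤ (2 * 5 ^ n) * volume F → μ Q ≤ K * μ F) : HullBounded μ := by
  refine ⟨K, fun E hE => ?_⟩
  -- Vitali's lemma needs bounded radii; the bound R is removed by monotone exhaustion.
  set t : ℕ → Set ((Fin n → ℝ) × ℝ) := fun R =>
    {a | (0 < a.2 ∧ a.2 ≤ R) ∧
      volume (closedBall a.1 a.2) ≤ 2 * volume (E ∩ closedBall a.1 a.2)} with ht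
  have hmono : Monotone fun R => ⋃ a ∈ t R, closedBall a.1 a.2 := by
    intro R R' hR
    exact biUnion_subset_biUnion_left fun a ha =>
      ⟨⟨ha.1.1, ha.1.2.trans (Nat.cast_le.2 hR)⟩, ha.2⟩
  have hsub : halfDensityHull E ⊆ ⋃ R, ⋃ a ∈ t R, closedBall a.1 a.2 := by
    rintro x ⟨Q, hQ, hxQ, hv⟩
    obtain ⟨c, r, hr, rfl⟩ := isCube_iff.1 hQ
    obtain ⟨R, hR⟩ := exists_nat_ge r
    exact mem_iUnion.2 ⟨R, mem_iUnion₂.2 ⟨(c, r), ⟨⟨hr, hR⟩, hv⟩, hxQ⟩⟩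
  refine (measure_mono hsub).trans ?_
  rw [hmono.measure_iUnion]
  refine iSup_le fun R => ?_
  obtain ⟨u, hut, huc, hd, hu⟩ := exists_disjoint_subfamily_closedBall (t R)
    (fun a ha => ha.1.1) (fun a ha => ha.1.2)
  have : Countable u := huc.to_subtype
  calc μ (⋃ a ∈ t R, closedBall a.1 a.2) ≤ μ (⋃ b ∈ u, closedBall b.1 (5 * b.2)) := by
        refine measure_mono (iUnion₂_subset fun a ha => ?_)
        obtain ⟨b, hb, hab⟩ := hu a ha
        exact hab.trans (subset_biUnion_of_mem (u := fun b : (Fin n → ℝ) × ℝ =>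
          closedBall b.1 (5 * b.2)) hb)
    _ ≤ ∑' b : u, μ (closedBall b.1.1 (5 * b.1.2)) := measure_biUnion_le _ huc _
    _ ≤ ∑' b : u, K * μ (E ∩ closedBall b.1.1 b.1.2) := by
        refine ENNReal.tsum_le_tsum fun b => ?_
        obtain ⟨⟨hb0, -⟩, hbv⟩ := hut b.2
        -- The fivefold cube has 5^n times the volume of a cube at least half filled by E, whence
        -- the factor 2 · 5^n.
        refine h _ _ (isCube_closedBall _ (by linarith)) (hE.inter measurableSet_closedBall)
          (inter_subset_right.trans (closedBall_subset_closedBall (by linarith))) ?_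
        rw [volume_closedBall_mul _ b.1.1 (by norm_num) hb0.le, mul_comm (2 : ℝ≥0∞), mul_assoc,
          ENNReal.ofReal_pow (by norm_num), ENNReal.ofReal_ofNat]
        gcongr
    _ = K * μ (⋃ b ∈ u, E ∩ closedBall b.1 b.2) := by
        rw [ENNReal.tsum_mul_left, measure_biUnion huc
          (hd.mono fun _ => inter_subset_right) fun b _ => hE.inter measurableSet_closedBall]
    _ ≤ K * μ E := by
        gcongr
        exact iUnion₂_subset fun _ _ => inter_subset_left

theorem IsAInfty.hullBounded {w : (Fin n → ℝ) → ℝ≥0} (hw : AEMeasurable w volume)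
    (h : IsAInfty w) : HullBounded (weightMeasure w) := by
  obtain ⟨q, hq, hA⟩ := h.exists_apConst_lt_top
  have hfin : (2 * 5 ^ n : ℝ≥0∞) ^ q * apConst q w ≠ ∞ :=
    ENNReal.mul_ne_top (ENNReal.rpow_ne_top_of_nonneg (by linarith)
      (ENNReal.mul_ne_top (by simp) (ENNReal.pow_ne_top (by simp)))) hA.ne
  refine hullBounded_of_forall_volume_le_mul
    (K := ((2 * 5 ^ n : ℝ≥0∞) ^ q * apConst q w).toNNReal) fun Q F hQ hF hFQ hD => ?_
  rw [ENNReal.coe_toNNReal hfin]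
  exact weightMeasure_le_mul_of_volume_le_mul hw hq hA hQ hF hFQ hD

/-! ### Enlarging a set inside a cube -/

theorem volume_inter_closedBall_ne_top (E : Set (Fin n → ℝ)) (c : Fin n → ℝ) (r : ℝ) :
    volume (E ∩ closedBall c r) ≠ ∞ :=
  measure_ne_top_of_subset inter_subset_right measure_closedBall_lt_top.ne

theorem toReal_volume_closedBall (c : Fin n → ℝ) {r : ℝ} (hr : 0 ≤ r) :
    (volume (closedBall c r)).toReal = (2 * r) ^ n := by
  rw [Real.volume_pi_closedBall _ hr, ENNReal.toReal_ofReal (by positivity), Fintype.card_fin]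

/-- Among the cubes shrinking to a point of a cube, the filled proportion varies continuously. -/
theorem exists_volume_eq_two_mul_volume_inter {E : Set (Fin n → ℝ)}
    {x c : Fin n → ℝ} {r s₀ : ℝ} (hr : 0 < r) (hx : x ∈ closedBall c r) (hs₀ : 0 < s₀)
    (hs₀1 : s₀ ≤ 1)
    (h0 : volume (closedBall (x + s₀ • (c - x)) (s₀ * r)) ≤
      2 * volume (E ∩ closedBall (x + s₀ • (c - x)) (s₀ * r)))
    (h1 : 2 * volume (E ∩ closedBall c r) ≤ volume (closedBall c r)) :
    ∃ s ∈ Icc s₀ 1, volume (closedBall (x + s • (c - x)) (s * r)) =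
      2 * volume (E ∩ closedBall (x + s • (c - x)) (s * r)) := by
  set B : ℝ → Set (Fin n → ℝ) := fun s => closedBall (x + s • (c - x)) (s * r) with hB
  set g : ℝ → ℝ := fun s => (volume (E ∩ B s)).toReal with hg
  set v : ℝ → ℝ := fun s => (2 * (s * r)) ^ n with hv
  have hvB (s : ℝ) (hs : 0 ≤ s) : (volume (B s)).toReal = v s :=
    toReal_volume_closedBall _ (by positivity)
  have hBt (s : ℝ) : volume (B s) ≠ ∞ := measure_closedBall_lt_top.ne
  have hEBt (s : ℝ) : volume (E ∩ B s) ≠ ∞ := volume_inter_closedBall_ne_top _ _ _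
  have hBm (s : ℝ) : MeasurableSet (B s) := measurableSet_closedBall
  have hsub (s t : ℝ) (hst : s ≤ t) : B s ⊆ B t := closedBall_homothety_subset hst hx
  -- For nested cubes the filled volume increases by no more than the cube volume, so it inherits
  -- continuity in s.
  have hle (s t : ℝ) (hs : 0 ≤ s) (hst : s ≤ t) : |g t - g s| ≤ |v t - v s| := by
    have h2 : g s ≤ g t :=
      ENNReal.toReal_mono (hEBt t) (measure_mono (inter_subset_inter_right _ (hsub s t hst)))
    have h3 : g t ≤ g s + (v t - v s) := by
      have h4 : E ∩ B t ⊆ (E ∩ B s) ∪ (B t \ B s) := by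
        rintro y ⟨hyE, hyt⟩
        by_cases hys : y ∈ B s
        · exact Or.inl ⟨hyE, hys⟩
        · exact Or.inr ⟨hyt, hys⟩
      have h5 : (volume (B t \ B s)).toReal = v t - v s := by
        rw [measure_sdiff (hsub s t hst) (hBm s).nullMeasurableSet (hBt s),
          ENNReal.toReal_sub_of_le (measure_mono (hsub s t hst)) (hBt t), hvB t (hs.trans hst),
          hvB s hs]
      rw [← h5, hg, ← ENNReal.toReal_add (hEBt s) (measure_ne_top_of_subset sdiff_subset (hBt t))]
      exact ENNReal.toReal_mono (ENNReal.add_ne_top.2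
        ⟨hEBt s, measure_ne_top_of_subset sdiff_subset (hBt t)⟩)
        ((measure_mono h4).trans (measure_union_le _ _))
    rw [abs_of_nonneg (by linarith)]
    exact (by linarith : g t - g s ≤ v t - v s).trans (le_abs_self _)
  have hvc : Continuous v := by fun_prop
  have hgc : ContinuousOn g (Icc s₀ 1) := by
    intro a ha
    refine tendsto_iff_dist_tendsto_zero.2 ?_
    refine squeeze_zero' (g := fun s => |v s - v a|) (Eventually.of_forall fun _ => dist_nonneg) ?_ ?_
    · filter_upwards [self_mem_nhdsWithin] with s hs
      rw [Real.dist_eq]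
      rcases le_total a s with has | has
      · exact hle a s (hs₀.le.trans ha.1) has
      · rw [abs_sub_comm, abs_sub_comm (v s)]
        exact hle s a (hs₀.le.trans hs.1) has
    · have : Tendsto (fun s => |v s - v a|) (𝓝[Icc s₀ 1] a) (𝓝 |v a - v a|) :=
        ((hvc.sub continuous_const).abs.tendsto a).mono_left nhdsWithin_le_nhds
      simpa using this
  have hcont : ContinuousOn (fun s => 2 * g s - v s) (Icc s₀ 1) :=
    (continuousOn_const.mul hgc).sub hvc.continuousOn
  have hB1 : B 1 = closedBall c r := by simp [hB]
  have hend1 : 2 * g 1 - v 1 ≤ 0 := by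
    rw [← hB1] at h1
    have := ENNReal.toReal_mono (hBt 1) h1
    rw [ENNReal.toReal_mul, ENNReal.toReal_ofNat, hvB 1 zero_le_one] at this
    linarith
  have hend0 : 0 ≤ 2 * g s₀ - v s₀ := by
    have := ENNReal.toReal_mono (ENNReal.mul_ne_top (by simp) (hEBt s₀)) h0
    rw [ENNReal.toReal_mul, ENNReal.toReal_ofNat, hvB s₀ hs₀.le] at this
    linarith
  obtain ⟨s, hs, hs0⟩ := intermediate_value_Icc' hs₀1 hcont ⟨hend1, hend0⟩
  refine ⟨s, hs, ?_⟩
  rw [← ENNReal.toReal_eq_toReal_iff' (hBt s) (ENNReal.mul_ne_top (by simp) (hEBt s)),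
    hvB s (hs₀.le.trans hs.1), ENNReal.toReal_mul, ENNReal.toReal_ofNat]
  simp only at hs0
  linarith

/-- Almost every point of a subset `E` of a cube that fills at most half of it lies in a subcube
half of which is filled by `E`. -/
theorem ae_exists_half_filled_subcube {E : Set (Fin n → ℝ)} (hE : MeasurableSet E)
    {c : Fin n → ℝ} {r : ℝ} (hr : 0 < r) (hEQ : E ⊆ closedBall c r)
    (h : 2 * volume E ≤ volume (closedBall c r)) :
    ∀ᵐ x ∂(volume.restrict E), ∃ (c' : Fin n → ℝ) (r' : ℝ), (0 < r' ∧ r' ≤ r) ∧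
      x ∈ closedBall c' r' ∧ closedBall c' r' ⊆ closedBall c r ∧
        volume (closedBall c' r') = 2 * volume (E ∩ closedBall c' r') := by
  -- At a density point x, small homothetic copies of the cube are more than half full, while the
  -- whole cube is at most half full; some copy in between is exactly half full.
  filter_upwards [IsUnifLocDoublingMeasure.ae_tendsto_measure_inter_div
    (volume : Measure (Fin n → ℝ)) E 1, ae_restrict_mem hE] with x hx hxE
  have hxQ := hEQ hxE
  have hlim : Tendsto (fun s : ℝ => s * r) (𝓝[>] 0) (𝓝[>] 0) := by
    refine tendsto_nhdsWithin_iff.2 ⟨?_, ?_⟩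
    · have : Tendsto (fun s : ℝ => s * r) (𝓝 0) (𝓝 (0 * r)) :=
        (continuous_id.mul continuous_const).tendsto 0
      rw [zero_mul] at this
      exact this.mono_left nhdsWithin_le_nhds
    · filter_upwards [self_mem_nhdsWithin] with s hs
      exact mul_pos hs hr
  have hT := hx (fun s : ℝ => x + s • (c - x)) (fun s => s * r) hlim (by
    filter_upwards [self_mem_nhdsWithin] with s hs
    rw [one_mul]
    exact mem_closedBall_homothety (le_of_lt hs) hxQ)
  have hev := (hT.eventually (lt_mem_nhds (ENNReal.inv_lt_one.2 (by norm_num : (1 : ℝ≥0∞) < 2)))).and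
    (Ioc_mem_nhdsGT (zero_lt_one (α := ℝ)))
  obtain ⟨s₀, hs₀, hs₀0, hs₀1⟩ := hev.exists
  have hs₀r : 0 < s₀ * r := mul_pos hs₀0 hr
  have hQ₀ := isCube_closedBall (x + s₀ • (c - x)) hs₀r
  obtain ⟨s, ⟨hs, hs1⟩, hsv⟩ := exists_volume_eq_two_mul_volume_inter hr hxQ hs₀0 hs₀1 (by
      rw [ENNReal.lt_div_iff_mul_lt (Or.inl hQ₀.volume_ne_zero) (Or.inl hQ₀.volume_ne_top)] at hs₀
      calc _ = 2 * (2⁻¹ * volume (closedBall (x + s₀ • (c - x)) (s₀ * r))) := by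
            rw [← mul_assoc, ENNReal.mul_inv_cancel (by simp) (by simp), one_mul]
        _ ≤ _ := by gcongr)
    (by rwa [inter_eq_left.2 hEQ])
  have hs0 : 0 < s := hs₀0.trans_le hs
  refine ⟨_, _, ⟨mul_pos hs0 hr, ?_⟩, mem_closedBall_homothety hs0.le hxQ,
    closedBall_homothety_subset_self hs1 hxQ, hsv⟩
  nlinarith

/-- Let U be a disjoint Vitali selection of subcubes exactly half filled by E, and F = E ∪ U. Then
|E| ≤ 5^n |U| and |U \ E| = |U| / 2, so F gains at least |E| / (2 · 5^n); fuller cubes might add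
nothing. As U lies in the hull, w-measure is controlled. -/
theorem exists_superset_volume_ge {μ : Measure (Fin n → ℝ)} {K : ℝ≥0}
    (hK : ∀ E, MeasurableSet E → μ (halfDensityHull E) ≤ K * μ E)
    {Q : Set (Fin n → ℝ)} (hQ : IsCube Q) {E : Set (Fin n → ℝ)} (hE : MeasurableSet E)
    (hEQ : E ⊆ Q) (h : 2 * volume E ≤ volume Q) :
    ∃ F, MeasurableSet F ∧ F ⊆ Q ∧ (2 * 5 ^ n + 1) * volume E ≤ 2 * 5 ^ n * volume F ∧
      μ F ≤ (K + 1) * μ E := by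
  obtain ⟨c, r, hr, rfl⟩ := isCube_iff.1 hQ
  set t : Set ((Fin n → ℝ) × ℝ) := {a | (0 < a.2 ∧ a.2 ≤ r) ∧
    closedBall a.1 a.2 ⊆ closedBall c r ∧
      volume (closedBall a.1 a.2) = 2 * volume (E ∩ closedBall a.1 a.2)} with ht
  obtain ⟨u, hut, huc, hd, hu⟩ := exists_disjoint_subfamily_closedBall t
    (fun a ha => ha.1.1) (fun a ha => ha.1.2)
  set U : Set (Fin n → ℝ) := ⋃ a ∈ u, closedBall a.1 a.2 with hU
  have hUm : MeasurableSet U := MeasurableSet.biUnion huc fun _ _ => measurableSet_closedBall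
  have hUE : volume (E ∩ U) = ∑' a : u, volume (E ∩ closedBall a.1.1 a.1.2) := by
    rw [hU, inter_iUnion₂, measure_biUnion huc (hd.mono fun _ => inter_subset_right)
      fun _ _ => hE.inter measurableSet_closedBall]
  have hUv : volume U = 2 * volume (E ∩ U) := by
    rw [hUE, hU, measure_biUnion huc hd fun _ _ => measurableSet_closedBall,
      ← ENNReal.tsum_mul_left]
    exact tsum_congr fun a => (hut a.2).2.2
  have hEcov : volume E ≤ 5 ^ n * volume U := by
    have hsub : E ≤ᵐ[volume] ⋃ b ∈ u, closedBall b.1 (5 * b.2) := by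
      have := (ae_restrict_iff' hE).1 (ae_exists_half_filled_subcube hE hr hEQ h)
      filter_upwards [this] with x hx hxE
      obtain ⟨c', r', hr', hxc', hsub, hv⟩ := hx hxE
      obtain ⟨b, hb, hb'⟩ := hu (c', r') ⟨hr', hsub, hv⟩
      exact mem_iUnion₂.2 ⟨b, hb, hb' hxc'⟩
    calc volume E ≤ volume (⋃ b ∈ u, closedBall b.1 (5 * b.2)) := measure_mono_ae hsub
      _ ≤ ∑' b : u, volume (closedBall b.1.1 (5 * b.1.2)) := measure_biUnion_le _ huc _
      _ = ∑' b : u, 5 ^ n * volume (closedBall b.1.1 b.1.2) := by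
        refine tsum_congr fun b => ?_
        rw [volume_closedBall_mul _ b.1.1 (by norm_num) (hut b.2).1.1.le,
          ENNReal.ofReal_pow (by norm_num), ENNReal.ofReal_ofNat]
      _ = 5 ^ n * volume U := by
        rw [ENNReal.tsum_mul_left, hU,
          measure_biUnion huc hd fun _ _ => measurableSet_closedBall]
  have hUhull : U ⊆ halfDensityHull E := iUnion₂_subset fun a ha =>
    (isCube_closedBall a.1 (hut ha).1.1).subset_halfDensityHull (hut ha).2.2.le
  have hUQ : U ⊆ closedBall c r := iUnion₂_subset fun a ha => (hut ha).2.1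
  have hEUt : volume (E ∩ U) ≠ ∞ :=
    measure_ne_top_of_subset (inter_subset_left.trans hEQ) hQ.volume_ne_top
  have hdiff : volume (U \ E) = volume (E ∩ U) := by
    have h1 := measure_inter_add_sdiff (μ := volume) U hE
    rw [hUv, two_mul, inter_comm] at h1
    exact (ENNReal.add_right_inj hEUt).1 h1
  refine ⟨E ∪ U, hE.union hUm, union_subset hEQ hUQ, ?_, ?_⟩
  · have h1 : volume (E ∪ U) = volume E + volume (E ∩ U) := by
      rw [← hdiff, ← union_sdiff_self, measure_union disjoint_sdiff_right (hUm.diff hE)]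
    rw [h1, mul_add, add_mul, one_mul]
    gcongr
    refine hEcov.trans_eq ?_
    rw [hUv]
    ring
  · refine (measure_union_le _ _).trans ?_
    rw [add_mul, one_mul, add_comm]
    gcongr
    exact (measure_mono hUhull).trans (hK E hE)

/-- Each enlargement costs a factor K + 1 and uses up one power of the volume ratio. Once E fills
half of Q, all of Q lies in its hull, which costs the last factor. -/
theorem measure_le_pow_mul_of_volume_le {μ : Measure (Fin n → ℝ)} {K : ℝ≥0}
    (hK : ∀ E, MeasurableSet E → μ (halfDensityHull E) ≤ K * μ E)
    {Q : Set (Fin n → ℝ)} (hQ : IsCube Q) (N : ℕ) {E : Set (Fin n → ℝ)} (hE : MeasurableSet E)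
    (hEQ : E ⊆ Q) (h : (2 * 5 ^ n) ^ N * volume Q ≤ 2 * ((2 * 5 ^ n + 1) ^ N * volume E)) :
    μ Q ≤ (K + 1) ^ (N + 1) * μ E := by
  have hbase : ∀ {E}, MeasurableSet E → E ⊆ Q → volume Q ≤ 2 * volume E → μ Q ≤ (K + 1) * μ E := by
    intro E hE hEQ h
    refine (measure_mono (hQ.subset_halfDensityHull (by rwa [inter_eq_left.2 hEQ]))).trans
      ((hK E hE).trans ?_)
    gcongr
    exact le_self_add
  induction N generalizing E with
  | zero => simpa using hbase hE hEQ (by simpa using h)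
  | succ N ih =>
    rcases le_total (volume Q) (2 * volume E) with hv | hv
    · refine (hbase hE hEQ hv).trans ?_
      gcongr
      exact le_self_pow₀ (by simp) (by omega)
    · obtain ⟨F, hF, hFQ, hFv, hFμ⟩ := exists_superset_volume_ge hK hQ hE hEQ hv
      have hB0 : (2 * 5 ^ n : ℝ≥0∞) ≠ 0 := by simp
      have hBt : (2 * 5 ^ n : ℝ≥0∞) ≠ ∞ := ENNReal.mul_ne_top (by simp) (ENNReal.pow_ne_top (by simp))
      have := ih hF hFQ (by
        refine (ENNReal.mul_le_mul_iff_right hB0 hBt).1 ?_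
        calc 2 * 5 ^ n * ((2 * 5 ^ n) ^ N * volume Q) = (2 * 5 ^ n) ^ (N + 1) * volume Q := by ring
          _ ≤ 2 * ((2 * 5 ^ n + 1) ^ (N + 1) * volume E) := h
          _ = 2 * ((2 * 5 ^ n + 1) ^ N * ((2 * 5 ^ n + 1) * volume E)) := by ring
          _ ≤ 2 * ((2 * 5 ^ n + 1) ^ N * (2 * 5 ^ n * volume F)) := by gcongr
          _ = _ := by ring)
      calc μ Q ≤ (K + 1) ^ (N + 1) * μ F := this
        _ ≤ (K + 1) ^ (N + 1) * ((K + 1) * μ E) := by gcongr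
        _ = _ := by ring

/-! ### From the hull estimate to A_q -/

theorem weightMeasure_congr {w v : (Fin n → ℝ) → ℝ≥0} (h : w =ᵐ[volume] v) :
    weightMeasure w = weightMeasure v :=
  withDensity_congr_ae (h.fun_comp _)

theorem apConst_congr {w v : (Fin n → ℝ) → ℝ≥0} (h : w =ᵐ[volume] v) (q : ℝ) :
    apConst q w = apConst q v := by
  refine iSup_congr fun Q => iSup_congr fun _ => ?_
  have h1 : ∫⁻ x in Q, (w x : ℝ≥0∞) = ∫⁻ x in Q, (v x : ℝ≥0∞) :=
    lintegral_congr_ae ((h.fun_comp fun y => (y : ℝ≥0∞)).restrict)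
  have h2 : ∫⁻ x in Q, (w x : ℝ≥0∞) ^ (-1 / (q - 1)) = ∫⁻ x in Q, (v x : ℝ≥0∞) ^ (-1 / (q - 1)) :=
    lintegral_congr_ae ((h.fun_comp fun y => (y : ℝ≥0∞) ^ (-1 / (q - 1))).restrict)
  rw [h1, h2]

theorem weightMeasure_le_mul_volume {w : (Fin n → ℝ) → ℝ≥0} {S : Set (Fin n → ℝ)}
    (hS : MeasurableSet S) {b : ℝ≥0∞} (h : ∀ x ∈ S, (w x : ℝ≥0∞) ≤ b) :
    weightMeasure w S ≤ b * volume S := by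
  rw [weightMeasure_apply w hS, ← setLIntegral_const]
  exact setLIntegral_mono' hS h

/-- Local integrability of w is not assumed: for large t the set {w ≤ t} fills half of Q and has
finite w-measure, which controls w(Q). -/
theorem weightMeasure_cube_ne_top {w : (Fin n → ℝ) → ℝ≥0} (hw : Measurable w)
    {K : ℝ≥0} (hK : ∀ E, MeasurableSet E →
      weightMeasure w (halfDensityHull E) ≤ K * weightMeasure w E)
    {Q : Set (Fin n → ℝ)} (hQ : IsCube Q) : weightMeasure w Q ≠ ∞ := by
  have : IsFiniteMeasure (volume.restrict Q) := ⟨by simpa using hQ.volume_ne_top.lt_top⟩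
  obtain ⟨t, ht⟩ := exists_measure_lt_lt (μ := volume.restrict Q) (g := fun x => (w x : ℝ))
    hw.coe_nnreal_real.aemeasurable (ENNReal.half_pos hQ.volume_ne_zero)
  rw [Measure.restrict_apply' hQ.measurableSet] at ht
  set S : Set (Fin n → ℝ) := {x | (w x : ℝ) ≤ t} ∩ Q with hS
  have hSm : MeasurableSet S :=
    (measurableSet_le hw.coe_nnreal_real measurable_const).inter hQ.measurableSet
  have hv : volume Q ≤ 2 * volume S := by
    have h1 : Q ⊆ ({x | t < (w x : ℝ)} ∩ Q) ∪ S := by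
      intro x hx
      rcases lt_or_ge t (w x : ℝ) with h | h
      · exact Or.inl ⟨h, hx⟩
      · exact Or.inr ⟨h, hx⟩
    have h2 : volume Q / 2 + volume Q / 2 ≤ volume Q / 2 + volume S := by
      rw [ENNReal.add_halves]
      exact (measure_mono h1).trans ((measure_union_le _ _).trans (by gcongr))
    have h3 := (ENNReal.add_le_add_iff_left
      (ENNReal.div_ne_top hQ.volume_ne_top two_ne_zero)).1 h2
    rw [← ENNReal.add_halves (volume Q), ← two_mul]
    gcongr
  refine ne_top_of_le_ne_top ?_ (measure_le_pow_mul_of_volume_le hK hQ 0 hSm inter_subset_right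
    (by simpa using hv))
  refine ENNReal.mul_ne_top (by simp) (ne_top_of_le_ne_top ?_
    (weightMeasure_le_mul_volume (b := ENNReal.ofReal t) hSm fun x hx => ?_))
  · exact ENNReal.mul_ne_top ENNReal.ofReal_ne_top
      (measure_ne_top_of_subset inter_subset_right hQ.volume_ne_top)
  · rw [← ENNReal.ofReal_coe_nnreal]
    exact ENNReal.ofReal_le_ofReal hx.1

/-- The sublevel sets of `w` in a cube decay geometrically. -/
theorem volume_sublevel_le {w : (Fin n → ℝ) → ℝ≥0} (hw : Measurable w)
    {K : ℝ≥0} (hK : ∀ E, MeasurableSet E →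
      weightMeasure w (halfDensityHull E) ≤ K * weightMeasure w E)
    {Q : Set (Fin n → ℝ)} (hQ : IsCube Q) (h0 : weightMeasure w Q ≠ 0) (N : ℕ) :
    volume (Q ∩ {x | (w x : ℝ≥0∞) < weightMeasure w Q / volume Q / (K + 2) ^ (N + 2)}) ≤
      (2 * 5 ^ n / (2 * 5 ^ n + 1)) ^ N * volume Q := by
  set B : ℝ≥0∞ := 2 * 5 ^ n with hB
  have hBt : B ≠ ∞ := ENNReal.mul_ne_top (by simp) (ENNReal.pow_ne_top (by simp))
  set a := weightMeasure w Q / volume Q with ha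
  set E : Set (Fin n → ℝ) := Q ∩ {x | (w x : ℝ≥0∞) < a / (K + 2) ^ (N + 2)} with hE
  have hEm : MeasurableSet E :=
    hQ.measurableSet.inter (measurableSet_lt hw.coe_nnreal_ennreal measurable_const)
  have hWt := weightMeasure_cube_ne_top hw hK hQ
  -- Otherwise w(Q) ≤ (K + 1)^(N+1) w(E) ≤ (K + 1)^(N+1) w(Q) / (K + 2)^(N+2) < w(Q). The base K + 2
  -- > 1 makes the last step strict, even for K = 0.
  have hlt : (2 * ((B + 1) ^ N * volume E)) < B ^ N * volume Q := by
    by_contra! hcon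
    have h1 := measure_le_pow_mul_of_volume_le hK hQ N hEm inter_subset_left hcon
    have h2 : weightMeasure w E ≤ a / (K + 2) ^ (N + 2) * volume Q :=
      (weightMeasure_le_mul_volume hEm fun x hx => (mem_ofPred_eq ▸ hx.2 :).le).trans
        (by gcongr; exact inter_subset_left)
    have h3 : a / (K + 2) ^ (N + 2) * volume Q = weightMeasure w Q / (K + 2) ^ (N + 2) := by
      rw [div_eq_mul_inv, mul_right_comm, ha, ENNReal.div_mul_cancel hQ.volume_ne_zero
        hQ.volume_ne_top, div_eq_mul_inv]
    have hlt' : ((K : ℝ≥0∞) + 1) ^ (N + 1) < (K + 2) ^ (N + 2) := by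
      have : (K + 1) ^ (N + 1) < (K + 2) ^ (N + 2) :=
        calc (K + 1) ^ (N + 1) ≤ (K + 2) ^ (N + 1) := by gcongr; norm_num
          _ < (K + 2) ^ (N + 2) := by
            refine pow_lt_pow_right₀ ?_ (by omega)
            exact lt_of_lt_of_le one_lt_two le_add_self
      exact_mod_cast this
    have hL0 : ((K : ℝ≥0∞) + 2) ^ (N + 2) ≠ 0 := by simp
    have hLt : ((K : ℝ≥0∞) + 2) ^ (N + 2) ≠ ∞ := ENNReal.pow_ne_top (by simp)
    refine absurd ?_ (lt_irrefl (weightMeasure w Q))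
    calc weightMeasure w Q
        ≤ (K + 1) ^ (N + 1) * (weightMeasure w Q / (K + 2) ^ (N + 2)) :=
          h1.trans (by rw [← h3]; gcongr)
      _ < (K + 2) ^ (N + 2) * (weightMeasure w Q / (K + 2) ^ (N + 2)) :=
          ENNReal.mul_lt_mul_left (ENNReal.div_ne_zero.2 ⟨h0, hLt⟩)
            (ENNReal.div_ne_top hWt hL0) hlt'
      _ = weightMeasure w Q := ENNReal.mul_div_cancel hL0 hLt
  have hB1 : (B + 1) ^ N ≠ 0 := by simp
  have hB1t : (B + 1) ^ N ≠ ∞ := ENNReal.pow_ne_top (by simp [hBt])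
  rw [div_eq_mul_inv, mul_pow, ← ENNReal.inv_pow, ← div_eq_mul_inv, ← ENNReal.mul_div_right_comm,
    ENNReal.le_div_iff_mul_le (Or.inl hB1)
    (Or.inl hB1t), mul_comm]
  refine le_trans ?_ hlt.le
  rw [two_mul]
  exact le_self_add

/-- Split the values y by the levels a / L^k: between levels N + 3 and N + 2, y^(-δ) is at most
a^(-δ) L^((N+3)δ). -/
theorem rpow_neg_le_tsum {y a L : ℝ≥0∞} {δ : ℝ} (hδ : 0 < δ) (ha0 : a ≠ 0) (hat : a ≠ ∞)
    (hL : 1 < L) (hLt : L ≠ ∞) :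
    y ^ (-δ) ≤ a ^ (-δ) * ((L ^ 2) ^ δ +
      ∑' N : ℕ, (L ^ (N + 3)) ^ δ * {z : ℝ≥0∞ | z < a / L ^ (N + 2)}.indicator 1 y) := by
  have hstep (k : ℕ) (hk : a / L ^ k ≤ y) : y ^ (-δ) ≤ a ^ (-δ) * (L ^ k) ^ δ := by
    have hk0 : L ^ k ≠ 0 := pow_ne_zero _ (zero_lt_one.trans hL).ne'
    have hkt : L ^ k ≠ ∞ := ENNReal.pow_ne_top hLt
    rw [ENNReal.rpow_neg, ENNReal.rpow_neg, ← ENNReal.inv_rpow, ← ENNReal.inv_rpow,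
      ← ENNReal.mul_rpow_of_nonneg _ _ hδ.le]
    gcongr
    rw [← ENNReal.inv_le_inv] at hk
    refine hk.trans_eq ?_
    rw [ENNReal.inv_div (Or.inl hkt) (Or.inl hk0), div_eq_mul_inv, mul_comm]
  by_cases h2 : a / L ^ 2 ≤ y
  · exact (hstep 2 h2).trans (by gcongr; exact le_self_add)
  push Not at h2
  -- If y lies below every level, all summands are at least 1 and the right side is ∞.
  by_cases hall : ∀ N : ℕ, y < a / L ^ (N + 2)
  · have htop : ∑' N : ℕ, (L ^ (N + 3)) ^ δ * {z : ℝ≥0∞ | z < a / L ^ (N + 2)}.indicator 1 y =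
        ∞ := by
      refine top_le_iff.1 ?_
      rw [← ENNReal.tsum_const_eq_top_of_ne_zero (α := ℕ) (one_ne_zero (α := ℝ≥0∞))]
      refine ENNReal.tsum_le_tsum fun N => ?_
      rw [indicator_of_mem (show y ∈ {z : ℝ≥0∞ | z < a / L ^ (N + 2)} from hall N), Pi.one_apply,
        mul_one]
      exact ENNReal.one_le_rpow (one_le_pow₀ hL.le) hδ
    rw [htop, add_top, ENNReal.mul_top (by simp [ha0, hat])]
    exact le_top
  · push Not at hall
    classical
    obtain ⟨m, hm⟩ : ∃ m, Nat.find hall = m + 1 := by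
      refine Nat.exists_eq_succ_of_ne_zero fun h => ?_
      have := Nat.find_spec hall
      rw [h] at this
      exact absurd h2 (not_lt.2 this)
    have hge := Nat.find_spec hall
    rw [hm] at hge
    have hlt : y < a / L ^ (m + 2) := by
      have := Nat.find_min hall (m := m) (by omega)
      push Not at this
      exact this
    refine (hstep _ hge).trans ?_
    gcongr
    refine le_trans ?_ le_add_self
    refine le_trans ?_ (ENNReal.le_tsum m)
    rw [indicator_of_mem (show y ∈ {z : ℝ≥0∞ | z < a / L ^ (m + 2)} from hlt), Pi.one_apply,
      mul_one, show m + 1 + 2 = m + 3 by ring]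

theorem exists_rpow_mul_lt_one {L θ : ℝ≥0∞} (hL0 : L ≠ 0) (hL : L ≠ ∞) (hθ : θ < 1) :
    ∃ δ : ℝ, 0 < δ ∧ L ^ δ * θ < 1 := by
  have hT : Tendsto (fun δ : ℝ => L ^ δ * θ) (𝓝[>] 0) (𝓝 (L ^ (0 : ℝ) * θ)) := by
    refine ENNReal.Tendsto.mul_const ?_ (Or.inr (hθ.trans ENNReal.one_lt_top).ne)
    lift L to ℝ≥0 using hL
    have hL0' : L ≠ 0 := by simpa using hL0
    have : Tendsto (fun δ : ℝ => ((L ^ δ : ℝ≥0) : ℝ≥0∞)) (𝓝[>] 0) (𝓝 ((L ^ (0 : ℝ) : ℝ≥0) : ℝ≥0∞)) := by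
      refine ENNReal.tendsto_coe.2 (Tendsto.mono_left ?_ nhdsWithin_le_nhds)
      exact (NNReal.continuousAt_rpow (x := L) (y := 0) (Or.inl hL0')).tendsto.comp
        ((continuous_const.prodMk continuous_id).tendsto (0 : ℝ))
    simpa only [ENNReal.coe_rpow_of_ne_zero hL0'] using this
  rw [ENNReal.rpow_zero, one_mul] at hT
  obtain ⟨δ, h1, h2⟩ := ((hT.eventually (gt_mem_nhds hθ)).and self_mem_nhdsWithin).exists
  exact ⟨δ, h2, h1⟩

/-- Integrating the level decomposition against the sublevel decay leaves a geometric series of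
ratio L^δ θ. -/
theorem lintegral_rpow_neg_le {w : (Fin n → ℝ) → ℝ≥0} (hw : Measurable w)
    {K : ℝ≥0} (hK : ∀ E, MeasurableSet E →
      weightMeasure w (halfDensityHull E) ≤ K * weightMeasure w E)
    {Q : Set (Fin n → ℝ)} (hQ : IsCube Q) (h0 : weightMeasure w Q ≠ 0) {δ : ℝ} (hδ : 0 < δ) :
    ∫⁻ x in Q, (w x : ℝ≥0∞) ^ (-δ) ≤
      (weightMeasure w Q / volume Q) ^ (-δ) * ((((K : ℝ≥0∞) + 2) ^ 2) ^ δ +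
        (((K : ℝ≥0∞) + 2) ^ 3) ^ δ *
          (1 - ((K : ℝ≥0∞) + 2) ^ δ * (2 * 5 ^ n / (2 * 5 ^ n + 1)))⁻¹) * volume Q := by
  set L : ℝ≥0∞ := K + 2 with hLdef
  set θ : ℝ≥0∞ := 2 * 5 ^ n / (2 * 5 ^ n + 1)
  set a := weightMeasure w Q / volume Q with ha
  have hL : 1 < L := lt_of_lt_of_le ENNReal.one_lt_two le_add_self
  have hLt : L ≠ ∞ := by simp [hLdef]
  have ha0 : a ≠ 0 := ENNReal.div_ne_zero.2 ⟨h0, hQ.volume_ne_top⟩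
  have hat : a ≠ ∞ := ENNReal.div_ne_top (weightMeasure_cube_ne_top hw hK hQ) hQ.volume_ne_zero
  have hms (N : ℕ) : MeasurableSet {x | (w x : ℝ≥0∞) < a / L ^ (N + 2)} :=
    measurableSet_lt hw.coe_nnreal_ennreal measurable_const
  have hind (N : ℕ) (x : Fin n → ℝ) :
      {z : ℝ≥0∞ | z < a / L ^ (N + 2)}.indicator (1 : ℝ≥0∞ → ℝ≥0∞) (w x) =
        {x | (w x : ℝ≥0∞) < a / L ^ (N + 2)}.indicator 1 x := rfl
  calc ∫⁻ x in Q, (w x : ℝ≥0∞) ^ (-δ)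
      ≤ ∫⁻ x in Q, a ^ (-δ) * ((L ^ 2) ^ δ + ∑' N : ℕ, (L ^ (N + 3)) ^ δ *
          {x | (w x : ℝ≥0∞) < a / L ^ (N + 2)}.indicator 1 x) := by
        refine lintegral_mono fun x => ?_
        simp only [← hind]
        exact rpow_neg_le_tsum hδ ha0 hat hL hLt
    _ = a ^ (-δ) * ((L ^ 2) ^ δ * volume Q + ∑' N : ℕ, (L ^ (N + 3)) ^ δ *
          volume (Q ∩ {x | (w x : ℝ≥0∞) < a / L ^ (N + 2)})) := by
        rw [lintegral_const_mul' _ _ (by simp [ha0, hat]), lintegral_add_left measurable_const,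
          setLIntegral_const, lintegral_tsum fun N =>
            ((measurable_one.indicator (hms N)).const_mul _).aemeasurable]
        congr 3
        ext N
        rw [lintegral_const_mul _ (measurable_one.indicator (hms N)), lintegral_indicator_one (hms N),
          Measure.restrict_apply (hms N), inter_comm]
    _ ≤ a ^ (-δ) * ((L ^ 2) ^ δ * volume Q + ∑' N : ℕ, (L ^ 3) ^ δ * volume Q * (L ^ δ * θ) ^ N) := by
        refine mul_le_mul_right (add_le_add_right (ENNReal.tsum_le_tsum fun N => ?_) _) _
        calc (L ^ (N + 3)) ^ δ * volume (Q ∩ {x | (w x : ℝ≥0∞) < a / L ^ (N + 2)})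
            ≤ (L ^ (N + 3)) ^ δ * (θ ^ N * volume Q) := by
              gcongr
              exact volume_sublevel_le hw hK hQ h0 N
          _ = (L ^ 3) ^ δ * volume Q * (L ^ δ * θ) ^ N := by
              rw [pow_add, ENNReal.mul_rpow_of_nonneg _ _ hδ.le, mul_pow, ← ENNReal.rpow_natCast,
                ← ENNReal.rpow_natCast (L ^ δ), ← ENNReal.rpow_mul, ← ENNReal.rpow_mul,
                mul_comm (N : ℝ)]
              ring
    _ = _ := by
        rw [ENNReal.tsum_mul_left, ENNReal.tsum_geometric]
        ring

theorem HullBounded.exists_apConst_lt_top {w : (Fin n → ℝ) → ℝ≥0} (hw : Measurable w)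
    (h : HullBounded (weightMeasure w)) : ∃ q : ℝ, 1 < q ∧ apConst q w < ∞ := by
  obtain ⟨K, hK⟩ := h
  have hBt : (2 * 5 ^ n : ℝ≥0∞) ≠ ∞ := ENNReal.mul_ne_top (by simp) (ENNReal.pow_ne_top (by simp))
  have hθ : (2 * 5 ^ n / (2 * 5 ^ n + 1) : ℝ≥0∞) < 1 := by
    rw [ENNReal.div_lt_iff (Or.inl (by simp)) (Or.inl (by simp [hBt])), one_mul]
    exact ENNReal.lt_add_right hBt one_ne_zero
  obtain ⟨δ, hδ, hδθ⟩ := exists_rpow_mul_lt_one (L := (K : ℝ≥0∞) + 2) (by simp) (by simp) hθ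
  set M : ℝ≥0∞ := ((((K : ℝ≥0∞) + 2) ^ 2) ^ δ + (((K : ℝ≥0∞) + 2) ^ 3) ^ δ *
          (1 - ((K : ℝ≥0∞) + 2) ^ δ * (2 * 5 ^ n / (2 * 5 ^ n + 1)))⁻¹) with hM
  have hMt : M ≠ ∞ := by
    have hk (k : ℕ) : (((K : ℝ≥0∞) + 2) ^ k) ^ δ ≠ ∞ :=
      ENNReal.rpow_ne_top_of_nonneg hδ.le (ENNReal.pow_ne_top (by simp))
    exact ENNReal.add_ne_top.2 ⟨hk 2, ENNReal.mul_ne_top (hk 3)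
      (ENNReal.inv_ne_top.2 (tsub_pos_of_lt hδθ).ne')⟩
  -- This q makes the dual exponent -1/(q - 1) equal to -δ.
  refine ⟨1 + 1 / δ, by simpa using hδ, lt_of_le_of_lt ?_
    (ENNReal.rpow_lt_top_of_nonneg (y := 1 / δ) (by positivity) hMt)⟩
  refine iSup₂_le fun Q hQ => ?_
  have he : -1 / (1 + 1 / δ - 1) = -δ := by
    field_simp
    ring
  rw [he, add_sub_cancel_left, ← weightMeasure_apply w hQ.measurableSet]
  rcases eq_or_ne (weightMeasure w Q) 0 with h0 | h0
  · simp [h0]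
  set a := weightMeasure w Q / volume Q with ha
  have ha0 : a ≠ 0 := ENNReal.div_ne_zero.2 ⟨h0, hQ.volume_ne_top⟩
  have hat : a ≠ ∞ := ENNReal.div_ne_top (weightMeasure_cube_ne_top hw hK hQ) hQ.volume_ne_zero
  calc a * ((∫⁻ x in Q, (w x : ℝ≥0∞) ^ (-δ)) / volume Q) ^ (1 / δ)
      ≤ a * (a ^ (-δ) * M) ^ (1 / δ) := by
        gcongr
        rw [ENNReal.div_le_iff hQ.volume_ne_zero hQ.volume_ne_top]
        exact lintegral_rpow_neg_le hw hK hQ h0 hδ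
    _ = M ^ (1 / δ) := by
        rw [ENNReal.mul_rpow_of_nonneg _ _ (by positivity), ← ENNReal.rpow_mul,
          show -δ * (1 / δ) = -1 by field_simp, ENNReal.rpow_neg_one, ← mul_assoc,
          ENNReal.mul_inv_cancel ha0 hat, one_mul]

theorem HullBounded.isAInfty {w : (Fin n → ℝ) → ℝ≥0} (hw : AEMeasurable w volume)
    (h : HullBounded (weightMeasure w)) : IsAInfty w := by
  rw [weightMeasure_congr hw.ae_eq_mk] at h
  obtain ⟨q, hq, hA⟩ := h.exists_apConst_lt_top hw.measurable_mk
  exact Or.inr ⟨q, hq, by rwa [apConst_congr hw.ae_eq_mk]⟩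

end MedianMaximal

theorem mainTheorem1 {n : ℕ} (hn : 1 ≤ n) (w : (Fin n → ℝ) → ℝ≥0) (hw : AEMeasurable w volume)
    (p : ℝ) (hp : 0 < p) :
    MedianMaximal.IsBoundedOnLp MedianMaximal.medianMaximal p w ↔ MedianMaximal.IsAInfty w :=
  ⟨fun h => (h.hullBounded hp).isAInfty hw, fun h => (h.hullBounded hw).isBoundedOnLp hp⟩
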